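/- Conventions. Sesquilinear forms are complex-valued. A Krein space is a complex vector space $\mathfrak K$ with a sesquilinear form $[\cdot,\cdot]$ for which $\mathfrak K=\mathfrak K^+\oplus\mathfrak K^-$, where $\mathfrak K^{+}$ and $\mathfrak K^-$ are subspaces orthogonal for $[\cdot,\cdot]$ and $(\mathfrak K^+,[\cdot,\cdot])$, $(\mathfrak K^-,-[\cdot,\cdot])$ are Hilbert spaces; the inner product associated with this (fundamental) decomposition is $(x,y)=[x^+,y^+]-[x^-,y^-]$. Let $\mathfrak h$ be a separable complex Hilbert space and let $W$ be a bounded self-adjoint operator on $\mathfrak h$ with $\ker W=\{0\}$ and $0\in\sigma(W)$. Let $\mathfrak h_W$ be the Hilbert space completion of $\mathfrak h$ for the inner product $[x,y]_J=\langle |W|x,y\rangle$, and let $[\cdot,\cdot]$ also denote the continuous extension to $\mathfrak h_W$ of the form $[x,y]=\langle Wx,y\rangle$ on $\mathfrak h$. For a finite Borel measure $\mu$ on $\sigma(W)\subset\mathbb R$, let $L^2(\sigma(W),x\,d\mu(x))$ be the Hilbert space $L^2(\sigma(W),|x|\,d\mu(x))$ equipped with the indefinite form $[f,g]=\int_{\sigma(W)}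 x\,f(x)\overline{g(x)}\,d\mu(x)$. Theorem. $(\mathfrak h_W,[\cdot,\cdot])$ is a Krein space, and $[\cdot,\cdot]_J$ is the inner product associated with one of its fundamental decompositions. There is a unitary operator $\mathcal U:\mathfrak h\to\mathfrak h_W$ with $\mathcal U\sqrt{|W|}\,x=x$ for all $x\in\mathfrak h$, and there are $N\in\{1,2,\dots\}\cup\{\infty\}$ and, for every index $n$ in a set of $N$ natural numbers ($0\le n<N$), a subspace $\mathfrak h_{\psi_n}\subset\mathfrak h$ invariant under $W$, a nonzero finite Borel measure $\mu_n$ on $\sigma(W)$ and a unitary operator $G_n:\mathfrak h_{\psi_n}\to L^2(\sigma(W),d\mu_n)$ such that $\mathfrak h=\bigoplus_n\mathfrak h_{\psi_n}$ (orthogonal Hilbert sum) and $(G_nWh)(x)=x\,(G_nh)(x)$ for $\mu_n$-almost every $x$ and every $h\in\mathfrak h_{\psi_n}$, and such that the following holds with $\mathfrak h^W_{\psi_n}:=\mathcal U\mathfrak h_{\psi_n}$. 1. $\mathfrak h_W=\bigoplus_n\mathfrak h^W_{\psi_n}$ is an orthogonal Hilbert sum for $[\cdot,\cdot]_J$, and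 its distinct summands are also orthogonal for $[\cdot,\cdot]$. 2. For every $n$, $\mathfrak h^W_{\psi_n}$ with the restriction of $[\cdot,\cdot]$, and $L^2(\sigma(W),x\,d\mu_n(x))$ with its indefinite form, are Krein spaces, and the inner product of $\mathfrak h_W$ restricted to $\mathfrak h^W_{\psi_n}$, respectively that of $L^2(\sigma(W),|x|\,d\mu_n(x))$, is associated with one of their fundamental decompositions. 3. For every $n$ these two Krein spaces are isomorphic: for every measurable $\psi:\sigma(W)\to\mathbb C$ with $|\psi(x)|^2=|x|$ for $\mu_n$-almost every $x$, there is a unitary operator $\Phi_n:\mathfrak h^W_{\psi_n}\to L^2(\sigma(W),|x|\,d\mu_n(x))$ that preserves the indefinite forms, $[\Phi_nu,\Phi_nv]=[u,v]$, and is given by $\Phi_n(\mathcal Uh)=(G_nh)/\psi$ $\mu_n$-almost everywhere, for all $h\in\mathfrak h_{\psi_n}$. -/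

import Mathlib

open MeasureTheory
open scoped ENNReal InnerProductSpace

noncomputable section

/-! ### Krein spaces -/

section Krein

variable {V : Type*} [AddCommGroup V] [Module ℂ V]

/-- `B` is a sesquilinear form (conjugate-linear in the first variable, as in Mathlib). -/
structure IsSesquilinearForm (B : V → V → ℂ) : Prop where
  add_left : ∀ x y z, B (x + y) z = B x z + B y z
  smul_left : ∀ (c : ℂ) x y, B (c • x) y = (starRingEnd ℂ) c * B x y
  add_right : ∀ x y z, B x (y + z) = B x y + B x z
  smul_right : ∀ (c : ℂ) x y, B x (c • y) = c * B x y

/-- The form `B` restricted to the subspace `S` is an inner product that makes `S` a Hilbert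
space: `B` is positive definite on `S`, and `S` is complete for the norm `√(B x x)`. -/
structure IsHilbertOn (B : V → V → ℂ) (S : Submodule ℂ V) : Prop where
  conj_symm : ∀ x ∈ S, ∀ y ∈ S, (starRingEnd ℂ) (B y x) = B x y
  pos : ∀ x ∈ S, x ≠ 0 → 0 < (B x x).re
  complete : ∀ u : ℕ → V, (∀ k, u k ∈ S) →
    (∀ ε > 0, ∃ K, ∀ k ≥ K, ∀ l ≥ K, (B (u k - u l) (u k - u l)).re < ε) →
    ∃ x ∈ S, ∀ ε > 0, ∃ K, ∀ k ≥ K, (B (u k - x) (u k - x)).re < ε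

/-- `V = P ⊕ M`, with `P` and `M` orthogonal for `B`, and `(P, B)` and `(M, -B)` Hilbert spaces. -/
structure IsFundamentalDecomposition (B : V → V → ℂ) (P M : Submodule ℂ V) : Prop where
  isCompl : IsCompl P M
  orthogonal : ∀ x ∈ P, ∀ y ∈ M, B x y = 0 ∧ B y x = 0
  hilbert_pos : IsHilbertOn B P
  hilbert_neg : IsHilbertOn (fun x y => -B x y) M

/-- `(V, B)` is a Krein space. -/
def IsKreinSpace (B : V → V → ℂ) : Prop :=
  IsSesquilinearForm B ∧ ∃ P M : Submodule ℂ V, IsFundamentalDecomposition B P M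

end Krein

/-- `(E, B)` is a Krein space, and the inner product of `E` is the one associated to it by some
fundamental decomposition, that is `(x, y) = [x⁺, y⁺] - [x⁻, y⁻]`
(equivalently `(x, y) = [J x, y]` for the fundamental symmetry `J`). -/
def IsKreinSpaceWithInner {E : Type*} [NormedAddCommGroup E] [InnerProductSpace ℂ E]
    (B : E → E → ℂ) : Prop :=
  IsSesquilinearForm B ∧ ∃ P M : Submodule ℂ E, IsFundamentalDecomposition B P M ∧
    ∀ p ∈ P, ∀ p' ∈ P, ∀ m ∈ M, ∀ m' ∈ M, inner ℂ (p + m) (p' + m') = B p p' - B m m'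

/-! ### The Krein space `H_W` of a Gram operator `W` -/

section Gram

variable {H : Type*} [NormedAddCommGroup H] [InnerProductSpace ℂ H] [CompleteSpace H]

/-- The pre-inner product `⟨T x, y⟩` of a positive operator `T`. -/
abbrev gramCore (T : H →L[ℂ] H) (hT : 0 ≤ T) : PreInnerProductSpace.Core ℂ H where
  inner x y := inner ℂ (T x) y
  conj_inner_symm x y := by
    rw [inner_conj_symm]
    exact (((ContinuousLinearMap.nonneg_iff_isPositive T).1 hT).isSymmetric x y).symm
  re_inner_nonneg x := ((ContinuousLinearMap.nonneg_iff_isPositive T).1 hT).re_inner_nonneg_left x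
  add_left x y z := by rw [map_add, inner_add_left]
  smul_left x y c := by rw [map_smul, inner_smul_left]

/-- The space `H`, equipped with the `J`-inner product `[x, y]_J = ⟨|W| x, y⟩` instead of its own
one, where `|W| = √(W* W)`. -/
def GramSpace (_W : H →L[ℂ] H) : Type _ := H

instance (W : H →L[ℂ] H) : AddCommGroup (GramSpace W) := inferInstanceAs (AddCommGroup H)

instance (W : H →L[ℂ] H) : Module ℂ (GramSpace W) := inferInstanceAs (Module ℂ H)

/-- The identity map of `H`, seen as a map to `H` with the `J`-inner product. -/
def toGram (W : H →L[ℂ] H) : H ≃ₗ[ℂ] GramSpace W := LinearEquiv.refl ℂ H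

/-- The `J`-inner product. -/
abbrev GramSpace.core (W : H →L[ℂ] H) : PreInnerProductSpace.Core ℂ (GramSpace W) :=
  gramCore (H := H) (CFC.abs W) (CFC.abs_nonneg W)

instance (W : H →L[ℂ] H) : SeminormedAddCommGroup (GramSpace W) :=
  @InnerProductSpace.Core.toSeminormedAddCommGroup ℂ _ _ _ _ (GramSpace.core W)

instance (W : H →L[ℂ] H) : InnerProductSpace ℂ (GramSpace W) :=
  InnerProductSpace.ofCore (GramSpace.core W)

theorem GramSpace.inner_eq (W : H →L[ℂ] H) (x y : H) :
    inner ℂ (toGram W x) (toGram W y) = inner ℂ (CFC.abs W x) y := rfl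

/-- The Hilbert space `H_W`: the completion of `H` for the `J`-norm. -/
abbrev GramCompletion (W : H →L[ℂ] H) : Type _ := UniformSpace.Completion (GramSpace W)

/-- The canonical map from `H` to `H_W`. -/
def toGramCompletion (W : H →L[ℂ] H) (x : H) : GramCompletion W := (toGram W x : GramSpace W)

theorem norm_inner_le_of_le (W T : H →L[ℂ] H) (hT : 0 ≤ T) (hTW : T ≤ CFC.abs W) (x y : H) :
    ‖inner ℂ (T x) y‖ ≤ ‖toGram W x‖ * ‖toGram W y‖ := by
  have h1 := @InnerProductSpace.Core.norm_inner_le_norm ℂ H _ _ _ (gramCore T hT) x y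
  have h2 : ∀ z : H, √(inner ℂ (T z) z).re ≤ √(inner ℂ (CFC.abs W z) z).re := fun z => by
    apply Real.sqrt_le_sqrt
    have h3 := ((ContinuousLinearMap.le_def T (CFC.abs W)).1 hTW).re_inner_nonneg_left z
    simpa [inner_sub_left] using h3
  exact h1.trans (mul_le_mul (h2 x) (h2 y) (Real.sqrt_nonneg _) (Real.sqrt_nonneg _))

theorem norm_gram_inner_le (W : H →L[ℂ] H) (hW : IsSelfAdjoint W) (x y : H) :
    ‖inner ℂ (W x) y‖ ≤ 2 * ‖toGram W x‖ * ‖toGram W y‖ := by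
  have hs := CFC.posPart_add_negPart W hW
  have hp := norm_inner_le_of_le W W⁺ (CFC.posPart_nonneg W)
    (hs ▸ le_add_of_nonneg_right (CFC.negPart_nonneg W)) x y
  have hn := norm_inner_le_of_le W W⁻ (CFC.negPart_nonneg W)
    (hs ▸ le_add_of_nonneg_left (CFC.posPart_nonneg W)) x y
  have hd : inner ℂ (W x) y = inner ℂ (W⁺ x) y - inner ℂ (W⁻ x) y := by
    conv_lhs => rw [← CFC.posPart_sub_negPart W hW]
    rw [sub_apply, inner_sub_left]
  rw [hd]
  refine (norm_sub_le _ _).trans ?_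
  linarith

/-- The `W`-metric `[x, y] = ⟨W x, y⟩` on `H`. -/
def gramForm (W : H →L[ℂ] H) (hW : IsSelfAdjoint W) :
    GramSpace W →L⋆[ℂ] GramSpace W →L[ℂ] ℂ :=
  LinearMap.mkContinuous₂
    (LinearMap.mk₂'ₛₗ (starRingEnd ℂ) (RingHom.id ℂ)
      (fun x y : GramSpace W => inner ℂ (W ((toGram W).symm x)) ((toGram W).symm y))
      (fun x y z => by rw [map_add, map_add, inner_add_left])
      (fun c x y => by rw [map_smul, map_smul, inner_smul_left]; rfl)
      (fun x y z => by rw [map_add, inner_add_right])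
      (fun c x y => by rw [map_smul, inner_smul_right]; rfl)) 2
    (fun x y => norm_gram_inner_le W hW ((toGram W).symm x) ((toGram W).symm y))

/-- The indefinite inner product of `H_W`: the continuous extension of the `W`-metric. -/
def kreinForm (W : H →L[ℂ] H) (hW : IsSelfAdjoint W) :
    GramCompletion W →L⋆[ℂ] GramCompletion W →L[ℂ] ℂ :=
  ((((gramForm W hW).extend UniformSpace.Completion.toComplL).flip).extend
    UniformSpace.Completion.toComplL).flip

theorem kreinForm_coe (W : H →L[ℂ] H) (hW : IsSelfAdjoint W) (x y : H) :
    kreinForm W hW (toGramCompletion W x) (toGramCompletion W y) = inner ℂ (W x) y := by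
  have hd : DenseRange (UniformSpace.Completion.toComplL (𝕜 := ℂ) (E := GramSpace W)) :=
    UniformSpace.Completion.denseRange_coe
  have hu : IsUniformInducing (UniformSpace.Completion.toComplL (𝕜 := ℂ) (E := GramSpace W)) :=
    UniformSpace.Completion.isUniformInducing_coe _
  have h1 := ContinuousLinearMap.extend_eq
    (((gramForm W hW).extend UniformSpace.Completion.toComplL).flip) hd hu (toGram W y)
  have h2 := ContinuousLinearMap.extend_eq (gramForm W hW) hd hu (toGram W x)
  have h3 := congrArg (fun T => T (toGramCompletion W x)) h1
  have h4 := congrArg (fun T => T (toGram W y)) h2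
  exact h3.trans h4

end Gram

/-! ### Spectral representations and weighted `L²` spaces -/

/-- The space `L²(σ, |x| dμ(x))`, for a measure `μ` on a set `σ` of real numbers. -/
abbrev WeightedL2 {σ : Set ℝ} (μ : Measure σ) : Type :=
  Lp ℂ 2 (μ.withDensity fun x => ENNReal.ofReal |(x : ℝ)|)

/-- The indefinite inner product `[f, g] = ∫ x conj(f(x)) g(x) dμ(x)` on `L²(σ, |x| dμ(x))`. -/
def weightedForm {σ : Set ℝ} (μ : Measure σ) (f g : WeightedL2 μ) : ℂ :=
  ∫ x : σ, ((x : ℝ) : ℂ) * ((starRingEnd ℂ) (f x) * g x) ∂μ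

/-- The multiplication-operator form of the spectral theorem for `W`: `H` is the orthogonal Hilbert
sum of `W`-invariant subspaces `V i`, and `G i` is a unitary from `V i` onto `L²(σ(W), μ i)`
that turns `W` into the multiplication by the independent variable; the `μ i` are nonzero finite
Borel measures on `σ(W)`. For a self-adjoint `W`, `spectrum ℝ W` is the whole spectrum. -/
structure IsSpectralRepresentation {H : Type*} [NormedAddCommGroup H] [InnerProductSpace ℂ H]
    [CompleteSpace H] (W : H →L[ℂ] H) {ι : Type} (V : ι → Submodule ℂ H)
    (μ : ι → Measure (spectrum ℝ W)) (G : ∀ i, V i ≃ₗᵢ[ℂ] Lp ℂ 2 (μ i)) : Prop where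
  isHilbertSum : IsHilbertSum ℂ (fun i => V i) (fun i => (V i).subtypeₗᵢ)
  finite : ∀ i, IsFiniteMeasure (μ i)
  ne_zero : ∀ i, μ i ≠ 0
  invariant : ∀ i, ∀ h ∈ V i, W h ∈ V i
  mul : ∀ i, ∀ h : V i,
    G i ⟨W h, invariant i h h.2⟩ =ᵐ[μ i] fun x => ((x : ℝ) : ℂ) * G i h x

end

noncomputable section

/-! ### Hilbert spaces with a symmetric involution are Krein spaces -/

section Involution

variable {E F : Type*} [NormedAddCommGroup E] [InnerProductSpace ℂ E]
  [NormedAddCommGroup F] [InnerProductSpace ℂ F]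

/-! Every form in the theorem is `⟨S x, y⟩` for a symmetric involution `S`, transported by a
unitary; the ±1 eigenspaces of `S` then give the fundamental decomposition.

Put `R = √|W|`. The `J`-norm of `x` is `‖R x‖`, and `R` has dense range because `ker W = 0`, so `R x
↦ x` extends to the unitary `U` (`exists_gramCompletion_equiv`). The form pulled back by `U` is
represented by a bounded `S` with `R S R = W`. Cancelling `R` on both sides shows that `S` is a
symmetric involution with `|W| S = W`, the sign of `W` (`exists_polar_involution`).

A maximal family of orthogonal cyclic subspaces gives the spectral representation, in which `|W|`
also acts as `|x|` (`exists_isSpectralRepresentation`). Hence `S` preserves each summand and acts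
there as the sign of `x`. Injectivity of `W` gives `μ_n {0} = 0`, so division by `ψ` with `|ψ|² =
|x|` is unitary onto the weighted space. It matches the forms because `x / |ψ|²` is the sign of `x`
(`weightedForm_eq_inner`). -/

theorem isHilbertOn_of_eq_inner [CompleteSpace E] {B : E → E → ℂ} {P : Submodule ℂ E}
    (hP : IsClosed (P : Set E)) (hB : ∀ x ∈ P, ∀ y ∈ P, B x y = inner ℂ x y) :
    IsHilbertOn B P where
  conj_symm x hx y hy := by rw [hB x hx y hy, hB y hy x hx, inner_conj_symm]
  pos x hx h0 := by
    rw [hB x hx x hx]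
    have h := inner_self_eq_norm_sq (𝕜 := ℂ) x
    have h' : (inner ℂ x x).re = ‖x‖ ^ 2 := h
    rw [h']
    exact pow_pos (norm_pos_iff.2 h0) 2
  complete u hu hc := by
    have hn : ∀ x ∈ P, (B x x).re = ‖x‖ ^ 2 := fun x hx => by
      rw [hB x hx x hx]
      exact inner_self_eq_norm_sq (𝕜 := ℂ) x
    have hcs : CauchySeq u := by
      rw [Metric.cauchySeq_iff]
      intro ε hε
      obtain ⟨K, hK⟩ := hc (ε ^ 2) (by positivity)
      refine ⟨K, fun k hk l hl => ?_⟩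
      have h := hK k hk l hl
      rw [hn _ (P.sub_mem (hu k) (hu l))] at h
      rw [dist_eq_norm]
      exact lt_of_pow_lt_pow_left₀ 2 hε.le h
    obtain ⟨x, hx⟩ := cauchySeq_tendsto_of_complete hcs
    have hxP : x ∈ P := hP.mem_of_tendsto hx (Filter.Eventually.of_forall hu)
    refine ⟨x, hxP, fun ε hε => ?_⟩
    obtain ⟨K, hK⟩ := Metric.tendsto_atTop.1 hx (√ε) (Real.sqrt_pos.2 hε)
    refine ⟨K, fun k hk => ?_⟩
    rw [hn _ (P.sub_mem (hu k) hxP), ← dist_eq_norm]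
    calc dist (u k) x ^ 2 < √ε ^ 2 := pow_lt_pow_left₀ (hK k hk) dist_nonneg two_ne_zero
      _ = ε := Real.sq_sqrt hε.le

/-- The eigenspaces of `S` for 1 and -1 are closed as kernels, orthogonal by symmetry of `S`, and
span because `x = (x + S x)/2 + (x - S x)/2`. -/
theorem isKreinSpaceWithInner_of_involution [CompleteSpace E] {B : E → E → ℂ} (S : E →L[ℂ] E)
    (hsymm : ∀ x y, inner ℂ (S x) y = inner ℂ x (S y)) (hinv : ∀ x, S (S x) = x)
    (hB : ∀ x y, B x y = inner ℂ (S x) y) : IsKreinSpaceWithInner B := by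
  have hP : ∀ x, x ∈ (S - 1).ker ↔ S x = x := fun x => by simp [sub_eq_zero]
  have hM : ∀ x, x ∈ (S + 1).ker ↔ S x = -x := fun x => by simp [add_eq_zero_iff_eq_neg]
  have horth : ∀ x, S x = x → ∀ y, S y = -y → inner ℂ x y = 0 := fun x hx y hy => by
    have h := hsymm x y
    rw [hx, hy, inner_neg_right] at h
    exact CharZero.eq_neg_self_iff.1 h
  refine ⟨⟨?_, ?_, ?_, ?_⟩, (S - 1).ker, (S + 1).ker, ⟨?_, ?_, ?_, ?_⟩, ?_⟩
  · intro x y z; simp [hB]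
  · intro c x y; rw [hB, hB, map_smul, inner_smul_left]
  · intro x y z; simp [hB]
  · intro c x y; rw [hB, hB, inner_smul_right]
  · refine IsCompl.of_eq ?_ ?_
    · rw [Submodule.eq_bot_iff]
      rintro x ⟨h1, h2⟩
      have h3 := horth x ((hP x).1 h1) x ((hM x).1 h2)
      exact inner_self_eq_zero.1 h3
    · rw [Submodule.eq_top_iff']
      intro x
      refine Submodule.mem_sup.2 ⟨(2⁻¹ : ℂ) • (x + S x), ?_, (2⁻¹ : ℂ) • (x - S x), ?_, ?_⟩
      · rw [hP, map_smul, map_add, hinv, add_comm]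
      · rw [hM, map_smul, map_sub, hinv, ← smul_neg, neg_sub]
      · module
  · intro x hx y hy
    have h := horth x ((hP x).1 hx) y ((hM y).1 hy)
    refine ⟨by rw [hB, (hP x).1 hx, h], ?_⟩
    rw [hB, (hM y).1 hy, inner_neg_left, inner_eq_zero_symm.1 h, neg_zero]
  · refine isHilbertOn_of_eq_inner (S - 1).isClosed_ker fun x hx y _ => ?_
    rw [hB, (hP x).1 hx]
  · refine isHilbertOn_of_eq_inner (S + 1).isClosed_ker fun x hx y _ => ?_
    rw [hB, (hM x).1 hx, inner_neg_left, neg_neg]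
  · intro p hp p' hp' m hm m' hm'
    rw [hP] at hp hp'
    rw [hM] at hm hm'
    rw [hB, hB, hp, hm, inner_add_left, inner_add_right, inner_add_right, horth p hp m' hm',
      inner_eq_zero_symm.1 (horth p' hp' m hm), inner_neg_left]
    ring

theorem isKreinSpaceWithInner_of_equiv [CompleteSpace E] [CompleteSpace F] {B : F → F → ℂ}
    (S : E →L[ℂ] E)
    (hsymm : ∀ x y, inner ℂ (S x) y = inner ℂ x (S y)) (hinv : ∀ x, S (S x) = x)
    (e : E ≃ₗᵢ[ℂ] F) (hB : ∀ x y, B (e x) (e y) = inner ℂ (S x) y) :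
    IsKreinSpaceWithInner B := by
  refine isKreinSpaceWithInner_of_involution
    ((e : E →L[ℂ] F) ∘L S ∘L (e.symm : F →L[ℂ] E)) (fun x y => ?_) (fun x => ?_)
    (fun x y => ?_)
  · obtain ⟨x, rfl⟩ := e.surjective x
    obtain ⟨y, rfl⟩ := e.surjective y
    simp [hsymm]
  · simp [hinv]
  · obtain ⟨x, rfl⟩ := e.surjective x
    obtain ⟨y, rfl⟩ := e.surjective y
    simp [hB]

/-- A norm-preserving map on a dense range extends to an isometry. -/
theorem exists_linearIsometry_of_denseRange {D : Type*} [AddCommGroup D] [Module ℂ D]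
    [CompleteSpace F] (e : D →ₗ[ℂ] E) (f : D →ₗ[ℂ] F) (he : DenseRange e)
    (hn : ∀ x, ‖f x‖ = ‖e x‖) : ∃ T : E →ₗᵢ[ℂ] F, ∀ x, T (e x) = f x := by
  have hb : ∃ C, ∀ x, ‖f x‖ ≤ C * ‖e x‖ := ⟨1, fun x => by rw [hn, one_mul]⟩
  refine ⟨⟨(f.extendOfNorm e : E →L[ℂ] F), fun x => ?_⟩, LinearMap.extendOfNorm_eq he hb⟩
  refine he.induction (P := fun x => ‖(f.extendOfNorm e : E →L[ℂ] F) x‖ = ‖x‖) ?_ ?_ x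
  · rintro _ ⟨y, rfl⟩
    rw [LinearMap.extendOfNorm_eq he hb, hn]
  · exact isClosed_eq (by fun_prop) (by fun_prop)

end Involution

/-! ### Injective symmetric operators, and the polar decomposition -/

section Gram

variable {H : Type*} [NormedAddCommGroup H] [InnerProductSpace ℂ H] [CompleteSpace H]

/-- A vector `x` orthogonal to the range satisfies `‖T x‖² = ⟨T (T x), x⟩ = 0`. -/
theorem denseRange_of_isSelfAdjoint {T : H →L[ℂ] H} (hT : IsSelfAdjoint T)
    (hinj : ∀ x, T x = 0 → x = 0) : DenseRange T := by
  have h : (T.range).topologicalClosure = ⊤ := by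
    rw [Submodule.topologicalClosure_eq_top_iff, Submodule.eq_bot_iff]
    intro x hx
    refine hinj x ?_
    have h1 := (Submodule.mem_orthogonal _ _).1 hx (T (T x)) ⟨T x, rfl⟩
    rw [hT.isSymmetric.apply_clm (T x) x] at h1
    exact inner_self_eq_zero.1 h1
  exact Submodule.dense_iff_topologicalClosure_eq_top.2 h

theorem norm_toGramCompletion (W : H →L[ℂ] H) (x : H) :
    ‖toGramCompletion W x‖ = ‖CFC.sqrt (CFC.abs W) x‖ := by
  have hR : IsSelfAdjoint (CFC.sqrt (CFC.abs W)) := (CFC.sqrt_nonneg _).isSelfAdjoint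
  have h : ‖toGramCompletion W x‖ = √(inner ℂ (CFC.abs W x) x).re :=
    UniformSpace.Completion.norm_coe _
  rw [h]
  conv_lhs => rw [← CFC.sqrt_mul_sqrt_self (CFC.abs W) (CFC.abs_nonneg W)]
  rw [mul_apply_eq_comp, hR.isSymmetric.apply_clm]
  have h2 : (inner ℂ (CFC.sqrt (CFC.abs W) x) (CFC.sqrt (CFC.abs W) x)).re =
      ‖CFC.sqrt (CFC.abs W) x‖ ^ 2 := inner_self_eq_norm_sq (𝕜 := ℂ) _
  rw [h2, Real.sqrt_sq (norm_nonneg _)]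

theorem abs_apply_eq_zero {W : H →L[ℂ] H} (hW : IsSelfAdjoint W) (hker : ∀ x, W x = 0 → x = 0)
    (x : H) (hx : CFC.abs W x = 0) : x = 0 := by
  have h : (CFC.abs W * CFC.abs W) x = 0 := by rw [mul_apply_eq_comp, hx, map_zero]
  rw [CFC.abs_mul_abs, hW.star_eq, mul_apply_eq_comp] at h
  exact hker _ (hker _ h)

theorem sqrt_abs_apply_eq_zero {W : H →L[ℂ] H} (hW : IsSelfAdjoint W)
    (hker : ∀ x, W x = 0 → x = 0) (x : H) (hx : CFC.sqrt (CFC.abs W) x = 0) : x = 0 := by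
  refine abs_apply_eq_zero hW hker x ?_
  rw [← CFC.sqrt_mul_sqrt_self (CFC.abs W) (CFC.abs_nonneg W), mul_apply_eq_comp, hx, map_zero]

theorem exists_gramCompletion_equiv {W : H →L[ℂ] H} (hW : IsSelfAdjoint W)
    (hker : ∀ x, W x = 0 → x = 0) :
    ∃ U : H ≃ₗᵢ[ℂ] GramCompletion W,
      ∀ x : H, U (CFC.sqrt (CFC.abs W) x) = toGramCompletion W x := by
  have hR : IsSelfAdjoint (CFC.sqrt (CFC.abs W)) := (CFC.sqrt_nonneg _).isSelfAdjoint
  obtain ⟨T, hT⟩ := exists_linearIsometry_of_denseRange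
    ((CFC.sqrt (CFC.abs W) : H →L[ℂ] H) : H →ₗ[ℂ] H)
    ((UniformSpace.Completion.toComplL (𝕜 := ℂ) (E := GramSpace W) :
      GramSpace W →ₗ[ℂ] GramCompletion W) ∘ₗ (toGram W : H →ₗ[ℂ] GramSpace W))
    (denseRange_of_isSelfAdjoint hR (sqrt_abs_apply_eq_zero hW hker))
    (fun x => norm_toGramCompletion W x)
  -- The range is closed, since `T` is isometric, and it contains the dense image of `H`.
  have hsurj : Function.Surjective T := by
    have hd : DenseRange T := by
      refine (UniformSpace.Completion.denseRange_coe (α := GramSpace W)).mono ?_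
      rintro _ ⟨x, rfl⟩
      exact ⟨_, hT ((toGram W).symm x)⟩
    rw [← Set.range_eq_univ, ← T.isometry.isClosedEmbedding.isClosed_range.closure_eq]
    exact hd.closure_range
  exact ⟨LinearIsometryEquiv.ofSurjective T hsurj, hT⟩

/-- Injectivity cancels `R` on the left, density of its range cancels it on the right. This replaces
multiplication by an inverse of `R`, which need not be bounded. -/
theorem eq_of_mul_mul_eq {R X Y : H →L[ℂ] H} (hR : IsSelfAdjoint R)
    (hinj : ∀ x, R x = 0 → x = 0) (h : R * X * R = R * Y * R) : X = Y := by
  have h1 : ∀ x, X (R x) = Y (R x) := fun x => by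
    rw [← sub_eq_zero]
    refine hinj _ ?_
    rw [map_sub, sub_eq_zero]
    exact congrArg (fun T : H →L[ℂ] H => T x) h
  have h2 := (denseRange_of_isSelfAdjoint hR hinj).equalizer X.continuous Y.continuous
    (funext h1)
  exact ContinuousLinearMap.ext (congrFun h2)

theorem exists_polar_involution {W : H →L[ℂ] H} (hW : IsSelfAdjoint W)
    (hker : ∀ x, W x = 0 → x = 0) (U : H ≃ₗᵢ[ℂ] GramCompletion W)
    (hU : ∀ x : H, U (CFC.sqrt (CFC.abs W) x) = toGramCompletion W x) :
    ∃ S : H →L[ℂ] H, (∀ x y, inner ℂ (S x) y = inner ℂ x (S y)) ∧ (∀ x, S (S x) = x) ∧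
      (∀ x, CFC.abs W (S x) = W x) ∧ ∀ x y, kreinForm W hW (U x) (U y) = inner ℂ (S x) y := by
  set R := CFC.sqrt (CFC.abs W) with hRdef
  have hR : IsSelfAdjoint R := (CFC.sqrt_nonneg _).isSelfAdjoint
  have hRR : R * R = CFC.abs W := CFC.sqrt_mul_sqrt_self (CFC.abs W) (CFC.abs_nonneg W)
  have hAA : CFC.abs W * CFC.abs W = W * W := by rw [CFC.abs_mul_abs, hW.star_eq]
  have hinj : ∀ x, R x = 0 → x = 0 := sqrt_abs_apply_eq_zero hW hker
  let B : H →L⋆[ℂ] H →L[ℂ] ℂ :=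
    (kreinForm W hW).bilinearComp (U : H →L[ℂ] GramCompletion W) (U : H →L[ℂ] GramCompletion W)
  let S : H →L[ℂ] H := InnerProductSpace.continuousLinearMapOfBilin B
  have hS : ∀ x y, kreinForm W hW (U x) (U y) = inner ℂ (S x) y := fun x y =>
    (InnerProductSpace.continuousLinearMapOfBilin_apply B x y).symm
  have hRSR : R * S * R = W := by
    ext x
    refine ext_inner_right ℂ fun y => ?_
    rw [← kreinForm_coe W hW x y, ← hU, ← hU, hS]
    exact hR.isSymmetric.apply_clm _ _
  -- The identities for `S` come from sandwiching: `R S* R = W* = W = R S R`; then `R (S R) R = W R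
  -- = R W = R (R S) R`; finally `|W| S S |W| = W W = |W| |W|`.
  have hSs : star S = S := by
    refine eq_of_mul_mul_eq hR hinj ?_
    rw [hRSR, ← hW.star_eq, ← hRSR, star_mul, star_mul, hR.star_eq, mul_assoc]
  have hcomm : R * W = W * R :=
    (Commute.cfcAbs_left (Commute.refl W) (hW.star_eq.symm ▸ Commute.refl W)).cfcₙ_nnreal NNReal.sqrt
  have hSR : S * R = R * S := by
    refine eq_of_mul_mul_eq hR hinj ?_
    rw [← mul_assoc, hRSR, ← hcomm, mul_assoc R (R * S) R, hRSR]
  have hAS : CFC.abs W * S = W := by rw [← hRR, mul_assoc, ← hSR, ← mul_assoc, hRSR]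
  have hSA : S * CFC.abs W = W := by rw [← hRR, ← mul_assoc, hSR, hRSR]
  have hSS : S * S = 1 := by
    refine eq_of_mul_mul_eq (CFC.abs_nonneg W).isSelfAdjoint (abs_apply_eq_zero hW hker) ?_
    rw [← mul_assoc, hAS, mul_assoc, hSA, mul_one, hAA]
  refine ⟨S, fun x y => ?_, fun x => ?_, fun x => ?_, hS⟩
  · exact (show IsSelfAdjoint S from hSs).isSymmetric.apply_clm x y
  · exact congrArg (fun T : H →L[ℂ] H => T x) hSS
  · exact congrArg (fun T : H →L[ℂ] H => T x) hAS

end Gram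

/-! ### The functional calculus of complex continuous functions on the real spectrum -/

section Spectral

variable {H : Type*} [NormedAddCommGroup H] [InnerProductSpace ℂ H] [CompleteSpace H]

theorem re_mem_spectrum {W : H →L[ℂ] H} (hW : IsSelfAdjoint W) {z : ℂ} (hz : z ∈ spectrum ℂ W) :
    z.re ∈ spectrum ℝ W := by
  rw [← spectrum.algebraMap_mem_iff ℂ]
  have h : z = (z.re : ℂ) := hW.mem_spectrum_eq_re hz
  exact h ▸ hz

/-- The real part, as a map from the complex to the real spectrum of a self-adjoint operator. -/
def spectrumRe {W : H →L[ℂ] H} (hW : IsSelfAdjoint W) : C(spectrum ℂ W, spectrum ℝ W) where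
  toFun z := ⟨(z : ℂ).re, re_mem_spectrum hW z.2⟩
  continuous_toFun := by fun_prop

/-- The continuous functional calculus of a self-adjoint operator, for complex-valued functions on
its real spectrum. -/
def realSpectrumCalculus {W : H →L[ℂ] H} (hW : IsSelfAdjoint W) :
    C(spectrum ℝ W, ℂ) →⋆ₐ[ℂ] (H →L[ℂ] H) :=
  (cfcHom (R := ℂ) (a := W) hW.isStarNormal).comp
    (ContinuousMap.compStarAlgHom' ℂ ℂ (spectrumRe hW))

/-- The inclusion of the real spectrum in the complex numbers. -/
def spectrumCoe (W : H →L[ℂ] H) : C(spectrum ℝ W, ℂ) := ⟨fun x => ((x : ℝ) : ℂ), by fun_prop⟩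

/-- The absolute value on the real spectrum. -/
def spectrumAbs (W : H →L[ℂ] H) : C(spectrum ℝ W, ℂ) := ⟨fun x => ((|(x : ℝ)| : ℝ) : ℂ), by fun_prop⟩

theorem realSpectrumCalculus_coe {W : H →L[ℂ] H} (hW : IsSelfAdjoint W) :
    realSpectrumCalculus hW (spectrumCoe W) = W := by
  have h : (spectrumCoe W).comp (spectrumRe hW) =
      (ContinuousMap.id ℂ).restrict (spectrum ℂ W) := by
    ext z
    exact (hW.mem_spectrum_eq_re z.2).symm
  calc realSpectrumCalculus hW (spectrumCoe W)
      = cfcHom (R := ℂ) (a := W) hW.isStarNormal ((spectrumCoe W).comp (spectrumRe hW)) := rfl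
    _ = W := by rw [h, cfcHom_id]

theorem realSpectrumCalculus_nonneg {W : H →L[ℂ] H} (hW : IsSelfAdjoint W)
    (g : C(spectrum ℝ W, ℂ)) : 0 ≤ realSpectrumCalculus hW (star g * g) := by
  rw [map_mul, map_star]
  exact star_mul_self_nonneg _

theorem star_sqrt_mul_sqrt {X : Type*} [TopologicalSpace X] (f : C(X, ℝ)) (hf : 0 ≤ f)
    (F : C(X, ℂ)) (hF : ∀ x, F x = f x) : ∃ g : C(X, ℂ), star g * g = F := by
  refine ⟨⟨fun x => ((√(f x) : ℝ) : ℂ), by fun_prop⟩, ?_⟩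
  ext x
  have hx : 0 ≤ f x := hf x
  have h : ((√(f x) : ℝ) : ℂ) * ((√(f x) : ℝ) : ℂ) = f x := by
    rw [← Complex.ofReal_mul, Real.mul_self_sqrt hx]
  simpa [hF] using h

/-- Uniqueness of the positive square root of `W* W`. It makes `|W|` act as multiplication by `|x|`
on cyclic subspaces. -/
theorem realSpectrumCalculus_abs {W : H →L[ℂ] H} (hW : IsSelfAdjoint W) :
    realSpectrumCalculus hW (spectrumAbs W) = CFC.abs W := by
  symm
  refine CFC.sqrt_unique ?_ ?_
  · have h : spectrumAbs W * spectrumAbs W = star (spectrumCoe W) * spectrumCoe W := by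
      ext x
      simp only [ContinuousMap.mul_apply, ContinuousMap.star_apply, spectrumAbs, spectrumCoe,
        ContinuousMap.coe_mk, ← Complex.ofReal_mul, abs_mul_abs_self]
      simp
    rw [← map_mul, h, map_mul, map_star, realSpectrumCalculus_coe]
  · obtain ⟨g, hg⟩ := star_sqrt_mul_sqrt
      (⟨fun x => |(x : ℝ)|, by fun_prop⟩ : C(spectrum ℝ W, ℝ)) (fun x => abs_nonneg _)
      (spectrumAbs W) (fun x => rfl)
    rw [← hg]
    exact realSpectrumCalculus_nonneg hW g

/-! ### Scalar spectral measures -/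

theorem inner_realSpectrumCalculus {W : H →L[ℂ] H} (hW : IsSelfAdjoint W)
    (f g : C(spectrum ℝ W, ℂ)) (x y : H) :
    inner ℂ (realSpectrumCalculus hW f x) (realSpectrumCalculus hW g y) =
      inner ℂ x (realSpectrumCalculus hW (star f * g) y) := by
  rw [map_mul, map_star, mul_apply_eq_comp, ContinuousLinearMap.star_eq_adjoint,
    ContinuousLinearMap.adjoint_inner_right]

/-- A real continuous function on a space, viewed as a complex one. -/
def ofRealMap {X : Type*} [TopologicalSpace X] : C(X, ℝ) →ₗ[ℝ] C(X, ℂ) where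
  toFun f := ⟨fun x => (f x : ℂ), by fun_prop⟩
  map_add' f g := by ext x; simp
  map_smul' c f := by ext x; simp

/-- The functional `f ↦ ⟨ψ, f(W) ψ⟩` on real functions. -/
def spectralFunctional {W : H →L[ℂ] H} (hW : IsSelfAdjoint W) (ψ : H) :
    CompactlySupportedContinuousMap (spectrum ℝ W) ℝ →ₚ[ℝ] ℝ :=
  PositiveLinearMap.mk₀
    { toFun := fun f => (inner ℂ ψ (realSpectrumCalculus hW (ofRealMap f.toContinuousMap) ψ)).re
      map_add' := fun f g => by
        have h : ofRealMap (f + g).toContinuousMap =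
          ofRealMap f.toContinuousMap + ofRealMap g.toContinuousMap := map_add ofRealMap _ _
        rw [h, map_add, add_apply, inner_add_right, Complex.add_re]
      map_smul' := fun c f => by
        have h : ofRealMap (c • f).toContinuousMap =
          (c : ℂ) • ofRealMap f.toContinuousMap := by ext x; simp [ofRealMap]
        rw [h, map_smul, smul_apply, inner_smul_right, Complex.re_ofReal_mul]
        rfl }
    fun f hf => by
      obtain ⟨g, hg⟩ := star_sqrt_mul_sqrt f.toContinuousMap hf (ofRealMap f.toContinuousMap)
        (fun x => rfl)
      change 0 ≤ (inner ℂ ψ (realSpectrumCalculus hW (ofRealMap f.toContinuousMap) ψ)).re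
      rw [← hg, ← inner_realSpectrumCalculus]
      exact inner_self_nonneg (𝕜 := ℂ)

/-- Riesz–Markov for `f ↦ ⟨ψ, f(W) ψ⟩`, evaluated at `|f|² = conj(f) f`. Regularity serves the
density of continuous functions in `L²(μ)`. -/
theorem exists_spectralMeasure {W : H →L[ℂ] H} (hW : IsSelfAdjoint W) (ψ : H) :
    ∃ μ : Measure (spectrum ℝ W), IsFiniteMeasure μ ∧ μ.Regular ∧ ∀ f : C(spectrum ℝ W, ℂ),
      ∫ x, ‖f x‖ ^ 2 ∂μ = ‖realSpectrumCalculus hW f ψ‖ ^ 2 := by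
  refine ⟨RealRMK.rieszMeasure (spectralFunctional hW ψ), inferInstance, inferInstance,
    fun f => ?_⟩
  let q : CompactlySupportedContinuousMap (spectrum ℝ W) ℝ :=
    CompactlySupportedContinuousMap.continuousMapEquiv ⟨fun x => ‖f x‖ ^ 2, by fun_prop⟩
  have h := RealRMK.integral_rieszMeasure (spectralFunctional hW ψ) q
  refine h.trans ?_
  have hq : ofRealMap q.toContinuousMap = star f * f := by
    ext x
    change ((‖f x‖ ^ 2 : ℝ) : ℂ) = (starRingEnd ℂ) (f x) * f x
    rw [Complex.conj_mul', Complex.ofReal_pow]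
  change (inner ℂ ψ (realSpectrumCalculus hW (ofRealMap q.toContinuousMap) ψ)).re = _
  rw [hq, ← inner_realSpectrumCalculus]
  exact inner_self_eq_norm_sq (𝕜 := ℂ) _

/-- The cyclic subspace of a vector is unitarily equivalent to an `L²` space. -/
theorem exists_cyclic_isometry {W : H →L[ℂ] H} (hW : IsSelfAdjoint W) (ψ : H) :
    ∃ μ : Measure (spectrum ℝ W), ∃ _ : IsFiniteMeasure μ, (ψ ≠ 0 → μ ≠ 0) ∧
      ∃ T : Lp ℂ 2 μ →ₗᵢ[ℂ] H,
        (DenseRange (ContinuousMap.toLp 2 μ ℂ : C(spectrum ℝ W, ℂ) →L[ℂ] Lp ℂ 2 μ)) ∧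
        ∀ f : C(spectrum ℝ W, ℂ), T (ContinuousMap.toLp 2 μ ℂ f) = realSpectrumCalculus hW f ψ := by
  obtain ⟨μ, hfin, hreg, hμ⟩ := exists_spectralMeasure hW ψ
  have hd : DenseRange (ContinuousMap.toLp 2 μ ℂ : C(spectrum ℝ W, ℂ) →L[ℂ] Lp ℂ 2 μ) :=
    ContinuousMap.toLp_denseRange ℂ μ ℂ (by simp)
  refine ⟨μ, hfin, fun hψ h0 => hψ ?_, ?_⟩
  -- With `f = 1`, the total mass is `‖ψ‖²`.
  · have h := hμ 1
    rw [h0, integral_zero_measure, map_one] at h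
    simpa using h.symm
  · obtain ⟨T, hT⟩ := exists_linearIsometry_of_denseRange
      (ContinuousMap.toLp 2 μ ℂ : C(spectrum ℝ W, ℂ) →L[ℂ] Lp ℂ 2 μ).toLinearMap
      ({ toFun := fun f => realSpectrumCalculus hW f ψ
         map_add' := fun f g => by rw [map_add, add_apply]
         map_smul' := fun c f => by rw [map_smul, smul_apply]; rfl } : C(spectrum ℝ W, ℂ) →ₗ[ℂ] H)
      hd (fun f => by
        rw [← sq_eq_sq₀ (norm_nonneg _) (norm_nonneg _)]
        refine (hμ f).symm.trans ?_
        have h1 := inner_self_eq_norm_sq (𝕜 := ℂ) (ContinuousMap.toLp 2 μ ℂ f)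
        refine Eq.trans ?_ h1
        rw [ContinuousMap.inner_toLp]
        simp_rw [RCLike.mul_conj]
        have h2 : ∀ x, ((‖f x‖ : ℝ) : ℂ) ^ 2 = ((‖f x‖ ^ 2 : ℝ) : ℂ) := fun x => by push_cast; rfl
        simp_rw [RCLike.ofReal_eq_complex_ofReal, h2]
        rw [integral_complex_ofReal]
        rfl)
    exact ⟨T, hd, hT⟩

end Spectral

/-! ### Cyclic subspaces and the spectral theorem in multiplication form -/

section Decomposition

variable {H : Type*} [NormedAddCommGroup H] [InnerProductSpace ℂ H] [CompleteSpace H]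

theorem completeSpace_of_linearIsometryEquiv {E F : Type*} [NormedAddCommGroup E]
    [NormedSpace ℂ E] [NormedAddCommGroup F] [NormedSpace ℂ F] [CompleteSpace E]
    (e : E ≃ₗᵢ[ℂ] F) : CompleteSpace F :=
  e.toIsometryEquiv.symm.completeSpace

theorem exists_continuousLinearMap_mul {X : Type*} [TopologicalSpace X] [CompactSpace X]
    [MeasurableSpace X] [BorelSpace X] (μ : Measure X) [IsFiniteMeasure μ]
    (f : C(X, ℂ)) :
    ∃ M : Lp ℂ 2 μ →L[ℂ] Lp ℂ 2 μ, ∀ F : Lp ℂ 2 μ, M F =ᵐ[μ] fun x => f x * F x := by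
  refine ⟨(ContinuousLinearMap.mul ℂ ℂ).holderL μ ∞ 2 2 (ContinuousMap.toLp ∞ μ ℂ f), fun F => ?_⟩
  have h1 := ContinuousLinearMap.coeFn_holder (r := 2) (ContinuousLinearMap.mul ℂ ℂ)
    (ContinuousMap.toLp ∞ μ ℂ f) F
  have h2 := ContinuousMap.coeFn_toLp (p := ∞) (𝕜 := ℂ) μ f
  refine Filter.EventuallyEq.trans h1 ?_
  filter_upwards [h2] with x hx
  rw [hx]
  rfl

/-- The cyclic subspace of `ψ`, with its spectral representation. -/
theorem exists_cyclic_subspace {W : H →L[ℂ] H} (hW : IsSelfAdjoint W) (ψ : H) :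
    ∃ (V : Submodule ℂ H) (μ : Measure (spectrum ℝ W)) (G : V ≃ₗᵢ[ℂ] Lp ℂ 2 μ),
      IsFiniteMeasure μ ∧ (ψ ≠ 0 → μ ≠ 0) ∧ ψ ∈ V ∧
      (∀ K : Submodule ℂ H, IsClosed (K : Set H) →
        (∀ f, realSpectrumCalculus hW f ψ ∈ K) → V ≤ K) ∧
      ∀ f : C(spectrum ℝ W, ℂ), ∀ h : V, ∃ hm : realSpectrumCalculus hW f h ∈ V,
        G ⟨realSpectrumCalculus hW f h, hm⟩ =ᵐ[μ] fun x => f x * G h x := by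
  obtain ⟨μ, hfin, hμ, T, hd, hT⟩ := exists_cyclic_isometry hW ψ
  -- `T` intertwines multiplication by `f` with `f(W)`: on a continuous `g` both sides are `(f g)(W)
  -- ψ`, and such `g` are dense.
  have hmul : ∀ f : C(spectrum ℝ W, ℂ), ∀ M : Lp ℂ 2 μ →L[ℂ] Lp ℂ 2 μ,
      (∀ F : Lp ℂ 2 μ, M F =ᵐ[μ] fun x => f x * F x) →
      ∀ F, T (M F) = realSpectrumCalculus hW f (T F) := by
    intro f M hM F
    refine hd.induction (P := fun F => T (M F) = realSpectrumCalculus hW f (T F)) ?_ ?_ F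
    · rintro _ ⟨g, rfl⟩
      have h1 : M (ContinuousMap.toLp 2 μ ℂ g) = ContinuousMap.toLp 2 μ ℂ (f * g) := by
        refine Lp.ext ?_
        filter_upwards [hM (ContinuousMap.toLp 2 μ ℂ g),
          ContinuousMap.coeFn_toLp (p := 2) (𝕜 := ℂ) μ g,
          ContinuousMap.coeFn_toLp (p := 2) (𝕜 := ℂ) μ (f * g)] with x h1 h2 h3
        rw [h1, h2, h3, ContinuousMap.mul_apply]
      rw [h1, hT, hT, map_mul, mul_apply_eq_comp]
    · exact isClosed_eq (by fun_prop) (by fun_prop)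
  refine ⟨LinearMap.range T.toLinearMap, μ, T.equivRange.symm, hfin, hμ, ?_, ?_, ?_⟩
  · refine ⟨ContinuousMap.toLp 2 μ ℂ 1, ?_⟩
    have h := hT 1
    rwa [map_one (realSpectrumCalculus hW)] at h
  · rintro K hK hf _ ⟨F, rfl⟩
    refine hd.induction (P := fun F => T F ∈ K) ?_ ?_ F
    · rintro _ ⟨g, rfl⟩
      rw [hT]
      exact hf g
    · exact hK.preimage T.continuous
  · intro f h
    obtain ⟨M, hM⟩ := exists_continuousLinearMap_mul μ f
    obtain ⟨F, rfl⟩ := T.equivRange.surjective h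
    have h1 : realSpectrumCalculus hW f (T.equivRange F) = T (M F) := (hmul f M hM F).symm
    have hm : realSpectrumCalculus hW f (T.equivRange F) ∈ LinearMap.range T.toLinearMap :=
      ⟨M F, h1.symm⟩
    refine ⟨hm, ?_⟩
    have h2 : (⟨realSpectrumCalculus hW f (T.equivRange F), hm⟩ : LinearMap.range T.toLinearMap) =
        T.equivRange (M F) := Subtype.ext h1
    rw [h2, LinearIsometryEquiv.symm_apply_apply, LinearIsometryEquiv.symm_apply_apply]
    exact hM F

theorem exists_equiv_natCast_lt (ι : Type*) [Countable ι] :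
    ∃ N : ℕ∞, Nonempty ({n : ℕ // (n : ℕ∞) < N} ≃ ι) := by
  rcases finite_or_infinite ι with h | h
  · obtain ⟨n, ⟨e⟩⟩ := Finite.exists_equiv_fin ι
    refine ⟨n, ⟨Equiv.trans ?_ e.symm⟩⟩
    exact (Equiv.subtypeEquivRight fun m => by simp).trans Fin.equivSubtype.symm
  · obtain ⟨e⟩ := nonempty_equiv_of_countable (α := ℕ) (β := ι)
    exact ⟨⊤, ⟨(Equiv.subtypeUnivEquiv fun n => ENat.natCast_lt_top n).trans e⟩⟩

omit [CompleteSpace H] in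
-- Distinct orthonormal vectors are at distance `√2`, so balls of radius `1/2` around them are
-- disjoint.
theorem countable_of_pairwise_inner_eq_zero [TopologicalSpace.SeparableSpace H] {S : Set H}
    (h1 : ∀ x ∈ S, ‖x‖ = 1) (h2 : S.Pairwise fun x y => inner ℂ x y = 0) : S.Countable := by
  refine Set.PairwiseDisjoint.countable_of_isOpen (s := fun x => Metric.ball x (1 / 2)) ?_
    (fun x _ => Metric.isOpen_ball) (fun x _ => ⟨x, Metric.mem_ball_self (by norm_num)⟩)
  intro x hx y hy hxy
  refine Metric.ball_disjoint_ball ?_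
  have h := norm_sub_sq (𝕜 := ℂ) x y
  rw [h2 hx hy hxy, h1 x hx, h1 y hy] at h
  rw [dist_eq_norm]
  norm_num at h ⊢
  nlinarith [norm_nonneg (x - y)]

/-- The spectral theorem in multiplication-operator form, together with the action of the
continuous functional calculus. -/
theorem exists_isSpectralRepresentation [TopologicalSpace.SeparableSpace H] [Nontrivial H]
    {W : H →L[ℂ] H} (hW : IsSelfAdjoint W) :
    ∃ (N : ℕ∞) (V : {n : ℕ // (n : ℕ∞) < N} → Submodule ℂ H)
      (μ : {n : ℕ // (n : ℕ∞) < N} → Measure (spectrum ℝ W))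
      (G : ∀ n, V n ≃ₗᵢ[ℂ] Lp ℂ 2 (μ n)),
      1 ≤ N ∧ IsSpectralRepresentation W V μ G ∧
      ∀ n, ∀ f : C(spectrum ℝ W, ℂ), ∀ h : V n, ∃ hm : realSpectrumCalculus hW f h ∈ V n,
        G n ⟨realSpectrumCalculus hW f h, hm⟩ =ᵐ[μ n] fun x => f x * G n h x := by
  -- Zorn's lemma for sets of unit vectors whose cyclic subspaces are pairwise orthogonal, stated
  -- through the functional calculus.
  obtain ⟨S, hS⟩ := zorn_subset {S : Set H | (∀ x ∈ S, ‖x‖ = 1) ∧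
    S.Pairwise fun x y => ∀ f, inner ℂ x (realSpectrumCalculus hW f y) = 0} (by
      intro c hc hchain
      refine ⟨⋃₀ c, ⟨?_, ?_⟩, fun s hs => Set.subset_sUnion_of_mem hs⟩
      · rintro x ⟨s, hs, hx⟩
        exact (hc hs).1 x hx
      · exact (Set.pairwise_sUnion hchain.directedOn).2 fun s hs => (hc hs).2)
  choose V μ G hfin hμ hψ hmin hmul using fun ψ : H => exists_cyclic_subspace hW ψ
  have hcomplete : ∀ ψ, CompleteSpace (V ψ) := fun ψ =>
    completeSpace_of_linearIsometryEquiv (G ψ).symm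
  have horth : ∀ x ∈ S, ∀ y ∈ S, x ≠ y → ∀ h ∈ V x, ∀ k ∈ V y, inner ℂ h k = 0 := by
    intro x hx y hy hxy
    -- Minimality of cyclic subspaces is used twice, starting from `⟨g(W) x, f(W) y⟩ = ⟨x, (conj(g)
    -- f)(W) y⟩ = 0`.
    have h1 : ∀ f, V x ≤ (Submodule.span ℂ {realSpectrumCalculus hW f y})ᗮ := fun f => by
      refine hmin x _ (Submodule.isClosed_orthogonal _) fun g => ?_
      rw [Submodule.mem_orthogonal_singleton_iff_inner_left, inner_realSpectrumCalculus]
      exact hS.1.2 hx hy hxy _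
    have h2 : V y ≤ (V x)ᗮ := by
      refine hmin y _ (Submodule.isClosed_orthogonal _) fun f => ?_
      rw [Submodule.mem_orthogonal]
      intro u hu
      exact Submodule.mem_orthogonal_singleton_iff_inner_left.1 (h1 f hu)
    intro h hh k hk
    exact (Submodule.mem_orthogonal _ _).1 (h2 hk) h hh
  have hdense : (⨆ x : S, V x).topologicalClosure = ⊤ := by
    rw [Submodule.topologicalClosure_eq_top_iff, Submodule.eq_bot_iff]
    intro z hz
    by_contra hz0
    rw [← Submodule.iInf_orthogonal, Submodule.mem_iInf] at hz
    -- A unit vector orthogonal to all the cyclic subspaces could be added to `S`. By maximality it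
    -- already lies in `S`, hence is orthogonal to itself.
    set u : H := ((‖z‖⁻¹ : ℝ) : ℂ) • z with hu
    have hu1 : ‖u‖ = 1 := by
      rw [hu, norm_smul, Complex.norm_real, norm_inv, norm_norm,
        inv_mul_cancel₀ (norm_ne_zero_iff.2 hz0)]
    have huV : ∀ x ∈ S, ∀ h ∈ V x, inner ℂ h u = 0 := fun x hx h hh =>
      (Submodule.mem_orthogonal _ _).1 ((V x)ᗮ.smul_mem _ (hz ⟨x, hx⟩)) h hh
    have hmem : insert u S ∈ {S : Set H | (∀ x ∈ S, ‖x‖ = 1) ∧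
        S.Pairwise fun x y => ∀ f, inner ℂ x (realSpectrumCalculus hW f y) = 0} := by
      refine ⟨?_, ?_⟩
      · rintro x (rfl | hx)
        · exact hu1
        · exact hS.1.1 x hx
      · refine Set.pairwise_insert.2 ⟨hS.1.2, fun x hx _ => ⟨fun f => ?_, fun f => ?_⟩⟩
        · obtain ⟨hm, -⟩ := hmul x f ⟨x, hψ x⟩
          exact inner_eq_zero_symm.1 (huV x hx _ hm)
        · obtain ⟨hm, -⟩ := hmul x (star f) ⟨x, hψ x⟩
          have h := inner_realSpectrumCalculus hW (star f) 1 x u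
          rw [map_one, star_star, mul_one] at h
          exact h.symm.trans (huV x hx _ hm)
    have huS : u ∈ S := hS.2 hmem (Set.subset_insert u S) (Set.mem_insert u S)
    have h0 := huV u huS u (hψ u)
    rw [inner_self_eq_zero] at h0
    rw [h0, norm_zero] at hu1
    exact zero_ne_one hu1
  have hcount : S.Countable := countable_of_pairwise_inner_eq_zero hS.1.1
    fun x hx y hy hxy => horth x hx y hy hxy x (hψ x) y (hψ y)
  have : Countable S := hcount
  obtain ⟨N, ⟨e⟩⟩ := exists_equiv_natCast_lt S
  refine ⟨N, fun n => V (e n), fun n => μ (e n), fun n => G (e n), ?_, ?_, fun n => hmul (e n)⟩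
  · rw [Order.one_le_iff_pos, pos_iff_ne_zero]
    rintro rfl
    have : IsEmpty S := e.isEmpty_congr.1 ⟨fun n => not_lt_zero n.2⟩
    rw [iSup_of_empty, Submodule.topologicalClosure_eq_top_iff, Submodule.bot_orthogonal_eq_top]
      at hdense
    exact top_ne_bot hdense
  · have hm : ∀ ψ (h : V ψ), ∃ hm : W h ∈ V ψ, G ψ ⟨W h, hm⟩ =ᵐ[μ ψ]
        fun x => ((x : ℝ) : ℂ) * G ψ h x := fun ψ h => by
      have h1 := hmul ψ (spectrumCoe W) h
      rw [realSpectrumCalculus_coe] at h1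
      exact h1
    refine ⟨?_, fun n => hfin _, fun n => hμ _ ?_, fun n h hh => (hm _ ⟨h, hh⟩).1,
      fun n h => (hm _ h).2⟩
    · refine IsHilbertSum.mkInternal _ ?_ ?_
      · intro m n hmn h k
        exact horth _ (e m).2 _ (e n).2 (fun h => hmn (e.injective (Subtype.ext h))) h h.2 k k.2
      · rw [e.iSup_comp (g := fun x : S => V x), hdense]
    · intro h
      have := hS.1.1 _ (e n).2
      rw [h, norm_zero] at this
      exact zero_ne_one this

end Decomposition

/-! ### The weighted space `L²(|x| dμ)` and division by a square root of the weight -/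

section Weighted

variable {σ : Set ℝ} {μ : Measure σ}

theorem measurable_weight : Measurable fun x : σ => ENNReal.ofReal |(x : ℝ)| := by fun_prop

/-- A density that vanishes almost nowhere keeps the null sets, so almost-everywhere statements pass
freely between the two measures. -/
theorem ae_withDensity_weight (h0 : ∀ᵐ x : σ ∂μ, (x : ℝ) ≠ 0) :
    ae (μ.withDensity fun x : σ => ENNReal.ofReal |(x : ℝ)|) = ae μ := by
  refine le_antisymm (withDensity_absolutelyContinuous μ _).ae_le
    (withDensity_absolutelyContinuous' measurable_weight.aemeasurable ?_).ae_le
  filter_upwards [h0] with x hx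
  simpa using hx

theorem eLpNorm_withDensity_weight (f g : σ → ℂ)
    (hfg : ∀ᵐ x ∂μ, ‖f x‖ ^ 2 = |(x : ℝ)| * ‖g x‖ ^ 2)  :
    eLpNorm g 2 (μ.withDensity fun x : σ => ENNReal.ofReal |(x : ℝ)|) = eLpNorm f 2 μ := by
  rw [eLpNorm_eq_lintegral_rpow_enorm_toReal two_ne_zero ENNReal.ofNat_ne_top,
    eLpNorm_eq_lintegral_rpow_enorm_toReal two_ne_zero ENNReal.ofNat_ne_top]
  congr 1
  rw [lintegral_withDensity_eq_lintegral_mul_non_measurable _ measurable_weight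
    (Filter.Eventually.of_forall fun x => ENNReal.ofReal_lt_top)]
  refine lintegral_congr_ae ?_
  filter_upwards [hfg] with x hx
  have h2 : (2 : ℝ≥0∞).toReal = (2 : ℕ) := by simp
  rw [Pi.mul_apply, h2, ENNReal.rpow_natCast, ENNReal.rpow_natCast, ← ofReal_norm, ← ofReal_norm,
    ← ENNReal.ofReal_pow (norm_nonneg _), ← ENNReal.ofReal_pow (norm_nonneg _), hx,
    ENNReal.ofReal_mul (abs_nonneg _)]

/-- Division by a square root `ψ` of the weight is unitary from `L²(μ)` onto `L²(|x| μ)`. -/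
theorem exists_weighted_equiv (h0 : ∀ᵐ x : σ ∂μ, (x : ℝ) ≠ 0) {ψ : σ → ℂ} (hm : Measurable ψ)
    (hψ : ∀ᵐ x ∂μ, ‖ψ x‖ ^ 2 = |(x : ℝ)|) :
    ∃ D : Lp ℂ 2 μ ≃ₗᵢ[ℂ] WeightedL2 μ, ∀ F, D F =ᵐ[μ] fun x => F x / ψ x := by
  have hae := ae_withDensity_weight h0
  have hψ0 : ∀ᵐ x ∂μ, ψ x ≠ 0 := by
    filter_upwards [h0, hψ] with x hx h h'
    rw [h', norm_zero] at h
    exact hx (abs_eq_zero.1 (by simpa using h.symm))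
  have hn : ∀ f : σ → ℂ, eLpNorm (fun x => f x / ψ x) 2
      (μ.withDensity fun x : σ => ENNReal.ofReal |(x : ℝ)|) = eLpNorm f 2 μ := fun f => by
    refine eLpNorm_withDensity_weight _ _ ?_
    filter_upwards [hψ, hψ0] with x h h'
    rw [← h, norm_div, div_pow, mul_div_cancel₀ _ (pow_ne_zero 2 (norm_ne_zero_iff.2 h'))]
  have hmem : ∀ F : Lp ℂ 2 μ, MemLp (fun x => F x / ψ x) 2
      (μ.withDensity fun x : σ => ENNReal.ofReal |(x : ℝ)|) := fun F => by
    refine ⟨?_, ?_⟩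
    · exact ((Lp.stronglyMeasurable F).measurable.div hm).aestronglyMeasurable
    · rw [hn]
      exact (Lp.memLp F).2
  have hcoe : ∀ F, (hmem F).toLp _ =ᵐ[μ] fun x => F x / ψ x := fun F => by
    have h := (hmem F).coeFn_toLp
    rwa [Filter.EventuallyEq, hae] at h
  have hext : ∀ F G : WeightedL2 μ, F =ᵐ[μ] G → F = G := fun F G h => by
    refine Lp.ext ?_
    rwa [Filter.EventuallyEq, hae]
  let D : Lp ℂ 2 μ →ₗᵢ[ℂ] WeightedL2 μ :=
    { toFun := fun F => (hmem F).toLp _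
      map_add' := fun F G => by
        refine hext _ _ ?_
        have h := Lp.coeFn_add ((hmem F).toLp _) ((hmem G).toLp _)
        rw [Filter.EventuallyEq, hae] at h
        filter_upwards [hcoe (F + G), hcoe F, hcoe G, Lp.coeFn_add F G, h] with x h1 h2 h3 h4 h5
        rw [h1, h5, Pi.add_apply, h2, h3, h4, Pi.add_apply, add_div]
      map_smul' := fun c F => by
        refine hext _ _ ?_
        have h := Lp.coeFn_smul c ((hmem F).toLp _)
        rw [Filter.EventuallyEq, hae] at h
        filter_upwards [hcoe (c • F), hcoe F, Lp.coeFn_smul c F, h] with x h1 h2 h3 h4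
        rw [h1, RingHom.id_apply, h4, Pi.smul_apply, h2, h3, Pi.smul_apply, smul_eq_mul,
          smul_eq_mul, mul_div_assoc]
      norm_map' := fun F => by
        change ‖(hmem F).toLp _‖ = ‖F‖
        rw [Lp.norm_toLp, hn, Lp.norm_def] }
  have hD : ∀ F, D F =ᵐ[μ] fun x => F x / ψ x := hcoe
  refine ⟨LinearIsometryEquiv.ofSurjective D fun g => ?_, hD⟩
  -- The preimage of `g` is `g ψ`.
  have hg : MemLp (fun x => g x * ψ x) 2 μ := by
    refine ⟨((Lp.stronglyMeasurable g).measurable.mul hm).aestronglyMeasurable, ?_⟩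
    rw [← eLpNorm_withDensity_weight (fun x => g x * ψ x) g]
    · exact (Lp.memLp g).2
    · filter_upwards [hψ] with x h
      rw [norm_mul, mul_pow, h, mul_comm]
  refine ⟨hg.toLp _, hext _ _ ?_⟩
  filter_upwards [hD (hg.toLp _), hg.coeFn_toLp, hψ0] with x h1 h2 h3
  rw [h1, h2, mul_div_cancel_right₀ _ h3]

/-- An isometry given by division by `ψ` carries the sign form to the weighted form. -/
theorem weightedForm_eq_inner (h0 : ∀ᵐ x : σ ∂μ, (x : ℝ) ≠ 0) {ψ : σ → ℂ}
    (hψ : ∀ᵐ x ∂μ, ‖ψ x‖ ^ 2 = |(x : ℝ)|) {f g : WeightedL2 μ} {F F' G : Lp ℂ 2 μ}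
    (hf : f =ᵐ[μ] fun x => F x / ψ x) (hg : g =ᵐ[μ] fun x => G x / ψ x)
    (hF : ∀ᵐ x : σ ∂μ, ((|(x : ℝ)| : ℝ) : ℂ) * F' x = ((x : ℝ) : ℂ) * F x) :
    weightedForm μ f g = inner ℂ F' G := by
  rw [L2.inner_def, weightedForm]
  refine integral_congr_ae ?_
  filter_upwards [h0, hψ, hf, hg, hF] with x h1 h2 h3 h4 h5
  have h6 : ((|(x : ℝ)| : ℝ) : ℂ) ≠ 0 := by
    rw [Complex.ofReal_ne_zero]
    exact abs_ne_zero.2 h1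
  have h7 : (starRingEnd ℂ) (ψ x) * ψ x = ((|(x : ℝ)| : ℝ) : ℂ) := by
    rw [Complex.conj_mul', ← h2, Complex.ofReal_pow]
  have h8 : ((|(x : ℝ)| : ℝ) : ℂ) * (starRingEnd ℂ) (F' x) =
      ((x : ℝ) : ℂ) * (starRingEnd ℂ) (F x) := by
    have := congrArg (starRingEnd ℂ) h5
    simpa using this
  -- After multiplication by `|x|`, the relation `conj(ψ) ψ = |x|` clears the denominators and `h8`
  -- trades `|x| conj(F')` for `x conj(F)`.
  refine mul_left_cancel₀ h6 ?_
  rw [h3, h4, RCLike.inner_apply', map_div₀, div_mul_div_comm, h7, ← mul_assoc _ _ (G x), h8]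
  field_simp

end Weighted

/-! ### Compatibility of the sign operator with the summands, and the main theorem -/

section Main

variable {H : Type*} [NormedAddCommGroup H] [InnerProductSpace ℂ H] [CompleteSpace H]

/-- The indicator of `{0}` represents a vector killed by `W`, hence zero; so `0` is not an atom. -/
theorem IsSpectralRepresentation.ae_ne_zero {W : H →L[ℂ] H} {ι : Type} {V : ι → Submodule ℂ H}
    {μ : ι → Measure (spectrum ℝ W)} {G : ∀ i, V i ≃ₗᵢ[ℂ] Lp ℂ 2 (μ i)}
    (hG : IsSpectralRepresentation W V μ G) (hker : ∀ x, W x = 0 → x = 0) (i : ι) :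
    ∀ᵐ x : spectrum ℝ W ∂μ i, (x : ℝ) ≠ 0 := by
  have := hG.finite i
  have hs : MeasurableSet {x : spectrum ℝ W | (x : ℝ) = 0} :=
    measurableSet_eq_fun measurable_subtype_coe measurable_const
  have hF : MemLp ({x : spectrum ℝ W | (x : ℝ) = 0}.indicator fun _ => (1 : ℂ)) 2 (μ i) :=
    memLp_indicator_const 2 hs 1 (Or.inr (measure_ne_top _ _))
  have h1 := hG.mul i ((G i).symm (hF.toLp _))
  rw [LinearIsometryEquiv.apply_symm_apply] at h1
  have h2 : G i ⟨W ((G i).symm (hF.toLp _)), hG.invariant i _ ((G i).symm (hF.toLp _)).2⟩ = 0 := by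
    refine Lp.ext ?_
    filter_upwards [h1, hF.coeFn_toLp, Lp.coeFn_zero ℂ 2 (μ i)] with x h1 h2 h3
    rw [h1, h2, h3]
    by_cases hx : (x : ℝ) = 0 <;> simp [hx]
  rw [LinearIsometryEquiv.map_eq_zero_iff] at h2
  have h3 : (G i).symm (hF.toLp _) = 0 := Subtype.ext (hker _ (congrArg Subtype.val h2))
  rw [LinearIsometryEquiv.map_eq_zero_iff] at h3
  have h4 := hF.coeFn_toLp
  rw [h3] at h4
  filter_upwards [h4, Lp.coeFn_zero ℂ 2 (μ i)] with x h4 h5 hx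
  rw [h5] at h4
  simp [hx] at h4

/-- If `A S = W` with `A` symmetric and injective, then `S` leaves every complete subspace invariant
that `A` and `W` leave invariant. -/
theorem apply_mem_of_symmetric_mul {A S W : H →L[ℂ] H} (hA : IsSelfAdjoint A)
    (hinj : ∀ x, A x = 0 → x = 0) (hAS : ∀ x, A (S x) = W x) {V : Submodule ℂ H} [CompleteSpace V]
    (hAV : ∀ h ∈ V, A h ∈ V) (hWV : ∀ h ∈ V, W h ∈ V) (h : H) (hh : h ∈ V) : S h ∈ V := by
  -- For the component `b` of `S h` orthogonal to `V`, the vector `A b = W h - A a` lies in `V`, and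
  -- by symmetry of `A` also in `Vᗮ`; so `A b = 0`.
  obtain ⟨a, ha, b, hb, hab⟩ := V.exists_add_mem_mem_orthogonal (S h)
  have h1 : A b ∈ Vᗮ := by
    rw [Submodule.mem_orthogonal]
    intro u hu
    rw [← hA.isSymmetric.apply_clm]
    exact (Submodule.mem_orthogonal _ _).1 hb _ (hAV u hu)
  have h2 : A b ∈ V := by
    have h3 : A b = W h - A a := by rw [← hAS, hab, map_add, add_sub_cancel_left]
    rw [h3]
    exact V.sub_mem (hWV h hh) (hAV a ha)
  have h4 : b = 0 := hinj b (inner_self_eq_zero.1 ((Submodule.mem_orthogonal _ _).1 h1 _ h2))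
  rw [hab, h4, add_zero]
  exact ha

/-- The restriction of a unitary operator to a subspace, onto the image of the subspace. -/
def LinearIsometryEquiv.mapSubmodule {E K : Type*} [NormedAddCommGroup E]
    [InnerProductSpace ℂ E] [NormedAddCommGroup K] [InnerProductSpace ℂ K] (U : E ≃ₗᵢ[ℂ] K)
    (V : Submodule ℂ E) : V ≃ₗᵢ[ℂ] V.map (U : E →ₗ[ℂ] K) :=
  { U.toLinearEquiv.submoduleMap V with norm_map' := fun x => U.norm_map x }

theorem IsHilbertSum.map_linearIsometryEquiv {ι : Type*} {K : Type*} [NormedAddCommGroup K]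
    [InnerProductSpace ℂ K] [CompleteSpace K] {V : ι → Submodule ℂ H} [∀ i, CompleteSpace (V i)]
    (hV : IsHilbertSum ℂ (fun i => V i) fun i => (V i).subtypeₗᵢ) (U : H ≃ₗᵢ[ℂ] K) :
    IsHilbertSum ℂ (fun i => (V i).map (U : H →ₗ[ℂ] K))
      fun i => ((V i).map (U : H →ₗ[ℂ] K)).subtypeₗᵢ := by
  have (i : ι) : CompleteSpace ((V i).map (U : H →ₗ[ℂ] K)) :=
    completeSpace_of_linearIsometryEquiv (U.mapSubmodule (V i))
  refine IsHilbertSum.mkInternal _ ?_ ?_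
  · rintro i j hij ⟨_, x, hx, rfl⟩ ⟨_, y, hy, rfl⟩
    exact (U.inner_map_map x y).trans (hV.OrthogonalFamily hij ⟨x, hx⟩ ⟨y, hy⟩)
  · have h1 : (⨆ i, V i).topologicalClosure = ⊤ := by
      have h := hV.OrthogonalFamily.range_linearIsometry
      rw [LinearMap.range_eq_top.2 hV.surjective_isometry] at h
      simpa [Submodule.range_subtype] using h.symm
    rw [Submodule.topologicalClosure_eq_top_iff, Submodule.eq_bot_iff] at h1
    rw [top_le_iff, Submodule.topologicalClosure_eq_top_iff, Submodule.eq_bot_iff]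
    intro z hz
    obtain ⟨z, rfl⟩ := U.surjective z
    have hz0 : z = 0 := by
      refine h1 z ?_
      rw [← Submodule.iInf_orthogonal, Submodule.mem_iInf] at hz ⊢
      intro i
      rw [Submodule.mem_orthogonal]
      intro u hu
      rw [← U.inner_map_map]
      exact (Submodule.mem_orthogonal _ _).1 (hz i) _ (Submodule.mem_map_of_mem hu)
    rw [hz0, map_zero]

end Main

end

theorem mainTheorem1 {H : Type*} [NormedAddCommGroup H] [InnerProductSpace ℂ H] [CompleteSpace H]
    [TopologicalSpace.SeparableSpace H] (W : H →L[ℂ] H) (hW : IsSelfAdjoint W)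
    (hker : LinearMap.ker (W : H →ₗ[ℂ] H) = ⊥) (h0 : (0 : ℂ) ∈ spectrum ℂ W) :
    IsKreinSpaceWithInner (fun x y => kreinForm W hW x y) ∧
    ∃ U : H ≃ₗᵢ[ℂ] GramCompletion W,
      (∀ x : H, U (CFC.sqrt (CFC.abs W) x) = toGramCompletion W x) ∧
      ∃ (N : ℕ∞) (V : {n : ℕ // (n : ℕ∞) < N} → Submodule ℂ H)
        (μ : {n : ℕ // (n : ℕ∞) < N} → Measure (spectrum ℝ W))
        (G : ∀ n, V n ≃ₗᵢ[ℂ] Lp ℂ 2 (μ n)),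
        1 ≤ N ∧ IsSpectralRepresentation W V μ G ∧
        IsHilbertSum ℂ (fun n => (V n).map (U : H →ₗ[ℂ] GramCompletion W))
          (fun n => ((V n).map (U : H →ₗ[ℂ] GramCompletion W)).subtypeₗᵢ) ∧
        (∀ m n, m ≠ n → ∀ h ∈ V m, ∀ k ∈ V n, kreinForm W hW (U h) (U k) = 0) ∧
        ∀ n,
          IsKreinSpaceWithInner
            (fun x y : (V n).map (U : H →ₗ[ℂ] GramCompletion W) =>
              kreinForm W hW (x : GramCompletion W) (y : GramCompletion W)) ∧
          IsKreinSpaceWithInner (weightedForm (μ n)) ∧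
          ∀ ψ : spectrum ℝ W → ℂ, Measurable ψ → (∀ᵐ x ∂μ n, ‖ψ x‖ ^ 2 = |(x : ℝ)|) →
            ∃ Φ : (V n).map (U : H →ₗ[ℂ] GramCompletion W) ≃ₗᵢ[ℂ] WeightedL2 (μ n),
              (∀ x y, weightedForm (μ n) (Φ x) (Φ y) =
                kreinForm W hW (x : GramCompletion W) (y : GramCompletion W)) ∧
              ∀ h : V n, Φ ⟨U h, Submodule.mem_map_of_mem h.2⟩ =ᵐ[μ n]
                fun x => G n h x / ψ x := by
  have hk : ∀ x, W x = 0 → x = 0 := fun x hx => by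
    have h : x ∈ LinearMap.ker (W : H →ₗ[ℂ] H) := hx
    rwa [hker, Submodule.mem_bot] at h
  -- On the zero space the spectrum would be empty. Nontriviality gives `1 ≤ N`.
  have : Nontrivial H := by
    by_contra hn
    rw [not_nontrivial_iff_subsingleton] at hn
    rw [spectrum.of_subsingleton] at h0
    exact h0
  obtain ⟨U, hU⟩ := exists_gramCompletion_equiv hW hk
  obtain ⟨S, hSs, hSS, hAS, hKS⟩ := exists_polar_involution hW hk U hU
  obtain ⟨N, V, μ, G, hN, hG, hmul⟩ := exists_isSpectralRepresentation hW
  have hcomplete (n) : CompleteSpace (V n) := completeSpace_of_linearIsometryEquiv (G n).symm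
  have hcompleteU (n) : CompleteSpace ((V n).map (U : H →ₗ[ℂ] GramCompletion W)) :=
    completeSpace_of_linearIsometryEquiv (U.mapSubmodule (V n))
  have habs : ∀ n (h : V n), ∃ hm : CFC.abs W h ∈ V n,
      G n ⟨CFC.abs W h, hm⟩ =ᵐ[μ n] fun x => ((|(x : ℝ)| : ℝ) : ℂ) * G n h x := fun n h => by
    have h1 := hmul n (spectrumAbs W) h
    rw [realSpectrumCalculus_abs] at h1
    exact h1
  have hSV : ∀ n, ∀ h ∈ V n, S h ∈ V n := fun n =>
    apply_mem_of_symmetric_mul (CFC.abs_nonneg W).isSelfAdjoint (abs_apply_eq_zero hW hk) hAS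
      (fun h hh => (habs n ⟨h, hh⟩).1) (hG.invariant n)
  refine ⟨isKreinSpaceWithInner_of_equiv S hSs hSS U hKS, U, hU, N, V, μ, G, hN, hG,
    hG.isHilbertSum.map_linearIsometryEquiv U, ?_, fun n => ?_⟩
  · intro m n hmn h hh k hk'
    rw [hKS]
    exact hG.isHilbertSum.OrthogonalFamily hmn ⟨S h, hSV m h hh⟩ ⟨k, hk'⟩
  let Sn : V n →L[ℂ] V n := (S ∘L (V n).subtypeL).codRestrict (V n) fun h => hSV n h h.2
  have hSns : ∀ x y, inner ℂ (Sn x) y = inner ℂ x (Sn y) := fun x y => hSs x y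
  have hSnn : ∀ x, Sn (Sn x) = x := fun x => Subtype.ext (hSS x)
  let e : V n ≃ₗᵢ[ℂ] (V n).map (U : H →ₗ[ℂ] GramCompletion W) :=
    U.mapSubmodule (V n)
  have he : ∀ h : V n, e h = ⟨U h, Submodule.mem_map_of_mem h.2⟩ := fun h => rfl
  have hne := hG.ae_ne_zero hk n
  -- Reading `|W| S = W` through `G n`: `S` becomes multiplication by the sign of `x`.
  have hsign : ∀ h : V n, ∀ᵐ x : spectrum ℝ W ∂μ n,
      ((|(x : ℝ)| : ℝ) : ℂ) * G n (Sn h) x = ((x : ℝ) : ℂ) * G n h x := fun h => by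
    obtain ⟨hm, h1⟩ := habs n (Sn h)
    have h2 : (⟨CFC.abs W (Sn h), hm⟩ : V n) = ⟨W h, hG.invariant n h h.2⟩ :=
      Subtype.ext (hAS h)
    rw [h2] at h1
    exact h1.symm.trans (hG.mul n h)
  have hform : ∀ ψ : spectrum ℝ W → ℂ, (∀ᵐ x ∂μ n, ‖ψ x‖ ^ 2 = |(x : ℝ)|) →
      ∀ D : Lp ℂ 2 (μ n) ≃ₗᵢ[ℂ] WeightedL2 (μ n), (∀ F, D F =ᵐ[μ n] fun x => F x / ψ x) →
      ∀ h k : V n, weightedForm (μ n) (D (G n h)) (D (G n k)) = inner ℂ (Sn h) k := by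
    intro ψ hψ D hD h k
    rw [weightedForm_eq_inner hne hψ (hD _) (hD _) (hsign h), LinearIsometryEquiv.inner_map_map]
  refine ⟨?_, ?_, fun ψ hψm hψ => ?_⟩
  · exact isKreinSpaceWithInner_of_equiv Sn hSns hSnn e fun x y => hKS x y
  -- The Krein property does not involve `ψ`; any admissible choice, here `√|x|`, transports the
  -- involution.
  · have hψ : ∀ᵐ x : spectrum ℝ W ∂μ n, ‖((√|(x : ℝ)| : ℝ) : ℂ)‖ ^ 2 = |(x : ℝ)| :=
      Filter.Eventually.of_forall fun x => by
        rw [Complex.norm_real, Real.norm_eq_abs, sq_abs, Real.sq_sqrt (abs_nonneg _)]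
    obtain ⟨D, hD⟩ := exists_weighted_equiv hne (by fun_prop) hψ
    exact isKreinSpaceWithInner_of_equiv Sn hSns hSnn ((G n).trans D)
      fun x y => hform _ hψ D hD x y
  · obtain ⟨D, hD⟩ := exists_weighted_equiv hne hψm hψ
    have hΦ : ∀ h, (e.symm.trans ((G n).trans D)) (e h) = D (G n h) := fun h =>
      congrArg (fun k => D (G n k)) (e.symm_apply_apply h)
    refine ⟨e.symm.trans ((G n).trans D), fun x y => ?_, fun h => ?_⟩
    · obtain ⟨x, rfl⟩ := e.surjective x
      obtain ⟨y, rfl⟩ := e.surjective y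
      rw [hΦ, hΦ]
      exact (hform ψ hψ D hD x y).trans (hKS x y).symm
    · rw [← he, hΦ]
      exact hD (G n h)
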